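/- Let $E$ be a complete separable metric (that is, Polish) real topological vector space and let $\mathcal P(E)$ be the set of Borel probability measures on $E$ with the weak topology. Write $\mu\nu$ for the convolution of $\mu,\nu\in\mathcal P(E)$, and $T(\mu)(B)=\mu(T^{-1}(B))$ for an invertible continuous linear operator $T$ on $E$. Let $(T_t)_{t>0}$ be a one-parameter group of invertible continuous linear operators on $E$, i.e. $T_{st}=T_sT_t$ for $s,t>0$ and $t\mapsto T_t x$ is continuous on $(0,\infty)$ for every $x\in E$, such that $T_t x\to 0$ as $t\to 0$ for every $x\in E$, and let $0<b<1$. A subset $H\subset\mathcal P(E)$ is called $(T_t)$-completely closed if it is closed, $\mu\nu\in H$ whenever $\mu,\nu\in H$, and $T_a(\mu)\,\delta_x\in H$ whenever $\mu\in H$, $a>0$, $x\in E$. For $H\subset\mathcal P(E)$ let $\tilde K(H,b,(T_t))$ be the set of all $\mu\in\mathcal P(E)$ for which there are a sequence $(\mu_n)$ in $H$, positive reals $(a_n)$, positive integers $k_1<k_2<\cdots$ and a sequence $(x_n)$ in $E$ with $$\frac{a_n}{a_{n+1}}\to b\qquad\text{and}\qquad T_{1/a_n}(\mu_1\mu_2\cdots\mu_{k_n})\,\delta_{x_n}\to\mu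 .$$ A measure $\mu\in\mathcal P(E)$ is called $T$-decomposable with co-factor $\nu\in\mathcal P(E)$ if $\mu=T(\mu)\,\nu$, and strongly $T$-decomposable with co-factor $\nu$ if moreover $T^n(\mu)\to\delta_0$ as $n\to\infty$. **Theorem.** Let $H\subset\mathcal P(E)$ be $(T_t)$-completely closed. Then: 1. $\tilde K(H,b,(T_t))$ is also $(T_t)$-completely closed. 2. For every $\mu\in\mathcal P(E)$ the following are equivalent: (i) $\mu\in\tilde K(H,b,(T_t))$; (ii) $\mu$ is $T_b$-decomposable with some (not necessarily unique) co-factor in $H$; (iii) $\mu$ is strongly $T_b$-decomposable with some (not necessarily unique) co-factor in $H$. -/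

import Mathlib

open MeasureTheory Filter Topology

namespace OperatorDecomposable

/-- The multiplicative group `(0, ∞)` of positive real numbers. -/
abbrev PosReal : Type := {r : ℝ // 0 < r}

section Convolution

variable {E : Type*} [AddCommGroup E] [MeasurableSpace E] [MeasurableAdd₂ E]

/-- Probability measures on `E` form a commutative monoid: the product is convolution and the
unit is the Dirac measure at `0`. -/
noncomputable instance convMonoid : CommMonoid (ProbabilityMeasure E) where
  mul μ ν := ⟨Measure.conv (μ : Measure E) (ν : Measure E), inferInstance⟩
  one := diracProba (0 : E)
  mul_assoc μ ν ρ :=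
    Subtype.ext (Measure.conv_assoc (μ : Measure E) (ν : Measure E) (ρ : Measure E))
  one_mul μ := Subtype.ext (Measure.dirac_zero_conv (μ : Measure E))
  mul_one μ := Subtype.ext (Measure.conv_dirac_zero (μ : Measure E))
  mul_comm μ ν := Subtype.ext (Measure.conv_comm (μ : Measure E) (ν : Measure E))

theorem coe_mul (μ ν : ProbabilityMeasure E) :
    ((μ * ν : ProbabilityMeasure E) : Measure E) =
      Measure.conv (μ : Measure E) (ν : Measure E) := rfl

theorem one_eq_dirac : (1 : ProbabilityMeasure E) = diracProba (0 : E) := rfl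

end Convolution

section Operators

variable {E : Type*} [AddCommGroup E] [Module ℝ E] [TopologicalSpace E]

/-- `T` is a one-parameter subgroup `(T_t)`, `t > 0`, of invertible continuous linear operators
(a homomorphism, `T_{st} = T_s T_t`), continuous for the strong operator topology, such that
`T_t x → 0` as `t → 0` for every `x`. -/
structure IsContractiveGroup (T : PosReal →* (E ≃L[ℝ] E)) : Prop where
  continuous : ∀ x : E, Continuous fun t : PosReal => T t x
  tendsto_zero : ∀ x : E,
    Tendsto (fun t : PosReal => T t x) (comap (fun t : PosReal => (t : ℝ)) (𝓝 0)) (𝓝 0)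

variable [MeasurableSpace E] [BorelSpace E]

/-- The image `T(μ)` of a probability measure: `T(μ)(B) = μ(T⁻¹(B))`. -/
noncomputable def image (T : E ≃L[ℝ] E) (μ : ProbabilityMeasure E) : ProbabilityMeasure E :=
  μ.map (f := fun x => T x) T.continuous.measurable.aemeasurable

variable [MeasurableAdd₂ E]

/-- `μ` is `T`-decomposable with co-factor `ν`: `μ = T(μ) ν`. -/
def IsDecomposableWith (T : E ≃L[ℝ] E) (μ ν : ProbabilityMeasure E) : Prop :=
  μ = image T μ * ν

/-- `μ` is strongly `T`-decomposable with co-factor `ν`: moreover `Tⁿ(μ) → δ₀`. -/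
def IsStronglyDecomposableWith (T : E ≃L[ℝ] E) (μ ν : ProbabilityMeasure E) : Prop :=
  IsDecomposableWith T μ ν ∧ Tendsto (fun n : ℕ => image (T ^ n) μ) atTop (𝓝 (diracProba 0))

/-- `H` is `(T_t)`-completely closed: a (weakly) closed subsemigroup of the convolution semigroup
of probability measures, containing `T_a(μ) * δ_x` for all `μ ∈ H`, `a > 0`, `x ∈ E`. -/
structure IsCompletelyClosed (T : PosReal →* (E ≃L[ℝ] E)) (H : Set (ProbabilityMeasure E)) :
    Prop where
  isClosed : IsClosed H
  mul_mem : ∀ μ ∈ H, ∀ ν ∈ H, μ * ν ∈ H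
  image_mul_dirac_mem : ∀ μ ∈ H, ∀ (a : PosReal) (x : E), image (T a) μ * diracProba x ∈ H

/-- The class `K̃(H, b, (T_t))`: all weak limits of `T_{1/a_n}(μ_1 ⋯ μ_{k_n}) δ_{x_n}` with
`μ_i ∈ H`, `a_n > 0`, `a_n / a_{n+1} → b`, `1 ≤ k_1 < k_2 < ⋯` and `x_n ∈ E`. The sequence of
measures is indexed from `0`, so that `μ_1 ⋯ μ_k` is the product over `range k`. -/
def KTilde (H : Set (ProbabilityMeasure E)) (b : PosReal) (T : PosReal →* (E ≃L[ℝ] E)) :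
    Set (ProbabilityMeasure E) :=
  {μ | ∃ (m : ℕ → ProbabilityMeasure E) (a : ℕ → PosReal) (k : ℕ → ℕ) (x : ℕ → E),
    (∀ i, m i ∈ H) ∧
    Tendsto (fun n => (a n : ℝ) / (a (n + 1) : ℝ)) atTop (𝓝 (b : ℝ)) ∧
    StrictMono k ∧ (∀ n, 1 ≤ k n) ∧
    Tendsto (fun n => image (T (a n)⁻¹) (∏ i ∈ Finset.range (k n), m i) * diracProba (x n))
      atTop (𝓝 μ)}

end Operators

end OperatorDecomposable

/-!
Consecutive terms `λₙ` of a normalized sequence defining `K̃` satisfy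
`λₙ₊₁ = T_{aₙ/aₙ₊₁}(λₙ) νₙ` with `νₙ ∈ H`. Since `T_{aₙ/aₙ₊₁}(λₙ) → T_b(μ)` and `λₙ₊₁ → μ`, the
`νₙ` form a tight sequence, and any of its limit points is a co-factor of `μ`. Conversely,
iterating `μ = T_b(μ) ν` gives `μ = T_bⁿ(μ) ∏_{i<n} T_bⁱ(ν)`, where `T_bⁿ(μ) → δ₀`, so `μ` is the
limit of the products of the `T_bⁱ(ν)`; these are the normalized products of `mᵢ = T_b⁻ⁱ(ν)` for
`aₙ = b⁻ⁿ`.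

Convergence `T_{aₙ/aₙ₊₁}(λₙ) → T_b(μ)` needs joint continuity of `(t, x) ↦ T_t x`, which follows
from separate continuity by a Banach–Steinhaus argument using only the additive group structure of
`E`.
-/

namespace OperatorDecomposable

section JointContinuity

variable {G G' : Type*} [AddGroup G] [TopologicalSpace G] [ContinuousAdd G] [BaireSpace G]
  [AddCommGroup G'] [TopologicalSpace G'] [IsTopologicalAddGroup G']

/-- The closed sets `{x | ∀ n ≥ m, A n x - A m x ∈ W}` cover `G`, so one of them has an interior
point, which is then moved to `0`. -/
theorem exists_eventually_nhds_zero_forall_ge_sub_mem {A : ℕ → G →+ G'} {B : G → G'}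
    (hA : ∀ n, Continuous (A n)) (hAB : ∀ x, Tendsto (fun n => A n x) atTop (𝓝 (B x)))
    {U : Set G'} (hU : U ∈ 𝓝 0) :
    ∃ m, ∀ᶠ x in 𝓝 0, ∀ n ≥ m, A n x - A m x ∈ U := by
  obtain ⟨V, hV, hVU⟩ := exists_nhds_half_neg hU
  obtain ⟨W, hW, hWclosed, hWV⟩ := exists_mem_nhds_isClosed_subset hV
  let F : ℕ → Set G := fun m => ⋂ n ≥ m, {x | A n x - A m x ∈ W}
  have hFclosed : ∀ m, IsClosed (F m) := fun m =>
    isClosed_biInter fun n _ => hWclosed.preimage ((hA n).sub (hA m))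
  have hFcover : ⋃ m, F m = Set.univ := by
    refine Set.eq_univ_of_forall fun x => Set.mem_iUnion.2 ?_
    have hcauchy : Tendsto (fun p : ℕ × ℕ => A p.1 x - A p.2 x) atTop (𝓝 0) := by
      rw [← prod_atTop_atTop_eq, ← sub_self (B x)]
      exact ((hAB x).comp tendsto_fst).sub ((hAB x).comp tendsto_snd)
    obtain ⟨⟨i, j⟩, hij⟩ := eventually_atTop.1 (hcauchy.eventually_mem hW)
    exact ⟨max i j, Set.mem_iInter₂.2 fun n hn =>
      hij (n, max i j) ⟨(le_max_left i j).trans hn, le_max_right i j⟩⟩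
  obtain ⟨m, x₀, hx₀⟩ := nonempty_interior_of_iUnion_of_closed hFclosed hFcover
  have hF_mem : ∀ x ∈ F m, ∀ n ≥ m, A n x - A m x ∈ V := fun x hx n hn =>
    hWV (Set.mem_iInter₂.1 hx n hn)
  have hnear : ∀ᶠ x in 𝓝 (0 : G), x₀ + x ∈ F m := by
    have htranslate : Tendsto (x₀ + ·) (𝓝 0) (𝓝 x₀) := by
      simpa only [add_zero] using (continuous_const_add x₀).tendsto 0
    exact htranslate.eventually (mem_interior_iff_mem_nhds.1 hx₀)
  refine ⟨m, hnear.mono fun x hx n hn => ?_⟩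
  have hsub := hVU _ (hF_mem _ hx n hn) _ (hF_mem _ (interior_subset hx₀) n hn)
  rwa [map_add, map_add, add_sub_add_comm, add_sub_cancel_left] at hsub

theorem tendsto_uncurry_atTop_nhds_zero {A : ℕ → G →+ G'} {B : G → G'}
    (hA : ∀ n, Continuous (A n)) (hAB : ∀ x, Tendsto (fun n => A n x) atTop (𝓝 (B x))) :
    Tendsto (fun p : ℕ × G => A p.1 p.2) (atTop ×ˢ 𝓝 0) (𝓝 0) := by
  intro U hU
  obtain ⟨V, hV, hVU⟩ := exists_nhds_zero_half hU
  obtain ⟨m, hm⟩ := exists_eventually_nhds_zero_forall_ge_sub_mem hA hAB hV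
  have hAm : ∀ᶠ x in 𝓝 0, A m x ∈ V :=
    (hA m).tendsto' 0 0 (map_zero _) |>.eventually_mem hV
  refine ((eventually_ge_atTop m).prod_mk (hm.and hAm)).mono fun ⟨n, x⟩ ⟨hn, hx, hmx⟩ => ?_
  simpa only [sub_add_cancel] using hVU _ (hx n hn) _ hmx

theorem continuous_uncurry_of_separately_continuous [FirstCountableTopology G] {X : Type*}
    [TopologicalSpace X] [FirstCountableTopology X] {A : X → G →+ G'}
    (hA : ∀ t, Continuous (A t)) (hA' : ∀ x, Continuous fun t => A t x) :
    Continuous fun p : X × G => A p.1 p.2 := by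
  refine continuous_iff_seqContinuous.2 fun p q hp => ?_
  have hfst : Tendsto (fun n => (p n).1) atTop (𝓝 q.1) := (continuous_fst.tendsto q).comp hp
  have hsnd : Tendsto (fun n => -q.2 + (p n).2) atTop (𝓝 0) := by
    simpa only [Function.comp_def, neg_add_cancel] using
      ((continuous_snd.tendsto q).comp hp).const_add (-q.2)
  have hpointwise : ∀ x, Tendsto (fun n => A (p n).1 x) atTop (𝓝 (A q.1 x)) := fun x =>
    ((hA' x).tendsto q.1).comp hfst
  have hincrement : Tendsto (fun n => A (p n).1 (-q.2 + (p n).2)) atTop (𝓝 0) :=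
    (tendsto_uncurry_atTop_nhds_zero (fun n => hA (p n).1) hpointwise).comp
      (tendsto_id.prodMk hsnd)
  simpa [Function.comp_def] using (hpointwise q.2).add hincrement

end JointContinuity

section WeakConvergence

theorem continuous_map_uncurry {X E F : Type*} [TopologicalSpace X] [SecondCountableTopology X]
    [TopologicalSpace.PseudoMetrizableSpace X] [TopologicalSpace E] [SecondCountableTopology E]
    [TopologicalSpace.PseudoMetrizableSpace E] [MeasurableSpace E] [OpensMeasurableSpace E]
    [TopologicalSpace F] [MeasurableSpace F] [BorelSpace F] {A : X → E → F}
    (hA : Continuous (Function.uncurry A)) :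
    Continuous fun p : X × ProbabilityMeasure E =>
      p.2.map (f := A p.1) (hA.uncurry_left p.1).measurable.aemeasurable := by
  borelize X
  have hprod : ∀ p : X × ProbabilityMeasure E,
      p.2.map (f := A p.1) (hA.uncurry_left p.1).measurable.aemeasurable =
        ((diracProba p.1).prod p.2).map hA.measurable.aemeasurable := fun p => by
    refine Subtype.ext ?_
    change (p.2 : Measure E).map (A p.1) =
      ((Measure.dirac p.1).prod (p.2 : Measure E)).map (Function.uncurry A)
    rw [Measure.dirac_prod, Measure.map_map hA.measurable (by fun_prop)]
    rfl
  simp_rw [hprod]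
  exact (ProbabilityMeasure.continuous_map hA).comp <|
    ProbabilityMeasure.continuous_prod.comp (continuous_diracProba.prodMap continuous_id)

theorem isTightMeasureSet_range_of_tendsto {E : Type*} [TopologicalSpace E]
    [TopologicalSpace.IsCompletelyPseudoMetrizableSpace E] [SecondCountableTopology E]
    [MeasurableSpace E] [BorelSpace E] {f : ℕ → ProbabilityMeasure E} {μ : ProbabilityMeasure E}
    (hf : Tendsto f atTop (𝓝 μ)) :
    IsTightMeasureSet (Set.range fun n => (f n : Measure E)) := by
  let := TopologicalSpace.upgradeIsCompletelyPseudoMetrizable E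
  have hcompact : IsCompact (closure (Set.range f)) :=
    hf.isCompact_insert_range.closure_of_subset (Set.subset_insert _ _)
  refine (isTightMeasureSet_of_isCompact_closure hcompact).subset ?_
  rintro _ ⟨n, rfl⟩
  exact ⟨f n, ⟨n, rfl⟩, rfl⟩

theorem exists_subseq_tendsto_of_isTightMeasureSet {E : Type*} [TopologicalSpace E]
    [PolishSpace E] [MeasurableSpace E] [BorelSpace E] {f : ℕ → ProbabilityMeasure E}
    (hf : IsTightMeasureSet (Set.range fun n => (f n : Measure E))) :
    ∃ (μ : ProbabilityMeasure E) (φ : ℕ → ℕ), StrictMono φ ∧ Tendsto (f ∘ φ) atTop (𝓝 μ) := by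
  have hcompact : IsCompact (closure (Set.range f)) := by
    refine isCompact_closure_of_isTightMeasureSet (hf.subset ?_)
    rintro _ ⟨_, ⟨n, rfl⟩, rfl⟩
    exact ⟨n, rfl⟩
  obtain ⟨μ, -, φ, hφ, hμ⟩ :=
    hcompact.tendsto_subseq (x := f) fun n => subset_closure (Set.mem_range_self n)
  exact ⟨μ, φ, hφ, hμ⟩

end WeakConvergence

section Convolution

open scoped Pointwise

variable {E : Type*} [AddCommGroup E] [MeasurableSpace E] [MeasurableAdd₂ E]

theorem diracProba_mul_diracProba (x y : E) :
    diracProba x * diracProba y = diracProba (x + y) :=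
  Subtype.ext (Measure.dirac_conv_dirac x y)

/-- If `x ∈ K` and `x + y ∈ L`, then `y ∈ L - K`. -/
theorem measure_compl_sub_le (μ ν : ProbabilityMeasure E) (K L : Set E) :
    (ν : Measure E) (L - K)ᶜ ≤
      (μ : Measure E) Kᶜ + ((μ * ν : ProbabilityMeasure E) : Measure E) Lᶜ := by
  let π : Measure (E × E) := (μ : Measure E).prod (ν : Measure E)
  have hsubset : Set.univ ×ˢ (L - K)ᶜ ⊆
      Kᶜ ×ˢ Set.univ ∪ (fun p : E × E => p.1 + p.2) ⁻¹' Lᶜ := by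
    rintro ⟨x, y⟩ ⟨-, hy⟩
    by_contra h
    simp only [Set.mem_union, Set.mem_prod, Set.mem_compl_iff, Set.mem_univ, and_true,
      Set.mem_preimage, not_or, not_not] at h
    exact hy ⟨x + y, h.2, x, h.1, add_sub_cancel_left x y⟩
  calc (ν : Measure E) (L - K)ᶜ
      = π (Set.univ ×ˢ (L - K)ᶜ) := by simp [π]
    _ ≤ π (Kᶜ ×ˢ Set.univ) + π ((fun p : E × E => p.1 + p.2) ⁻¹' Lᶜ) :=
      (measure_mono hsubset).trans (measure_union_le _ _)
    _ ≤ (μ : Measure E) Kᶜ + ((μ * ν : ProbabilityMeasure E) : Measure E) Lᶜ := by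
      gcongr
      · simp [π]
      · exact Measure.le_map_apply measurable_add.aemeasurable Lᶜ

variable [TopologicalSpace E] [IsTopologicalAddGroup E]

theorem isTightMeasureSet_range_of_mul {ι : Type*} {f g : ι → ProbabilityMeasure E}
    (hf : IsTightMeasureSet (Set.range fun i => (f i : Measure E)))
    (hfg : IsTightMeasureSet
      (Set.range fun i => ((f i * g i : ProbabilityMeasure E) : Measure E))) :
    IsTightMeasureSet (Set.range fun i => (g i : Measure E)) := by
  simp only [isTightMeasureSet_iff_exists_isCompact_measure_compl_le, Set.forall_mem_range]
    at hf hfg ⊢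
  intro ε hε
  obtain ⟨K, hK, hfK⟩ := hf (ε / 2) (ENNReal.half_pos hε.ne')
  obtain ⟨L, hL, hfgL⟩ := hfg (ε / 2) (ENNReal.half_pos hε.ne')
  have hLK : IsCompact (L - K) := by
    simpa only [← Set.image_prod, Set.sub_image_prod] using (hL.prod hK).image continuous_sub
  refine ⟨L - K, hLK, fun i => ?_⟩
  calc (g i : Measure E) (L - K)ᶜ
      ≤ (f i : Measure E) Kᶜ + ((f i * g i : ProbabilityMeasure E) : Measure E) Lᶜ :=
        measure_compl_sub_le (f i) (g i) K L
    _ ≤ ε / 2 + ε / 2 := add_le_add (hfK i) (hfgL i)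
    _ = ε := ENNReal.add_halves ε

end Convolution

section Factors

variable {E : Type*} [AddCommGroup E] [TopologicalSpace E] [IsTopologicalAddGroup E]
  [PolishSpace E] [MeasurableSpace E] [BorelSpace E]

instance : ContinuousMul (ProbabilityMeasure E) where
  continuous_mul := (ProbabilityMeasure.continuous_map (continuous_add (M := E))).comp
    ProbabilityMeasure.continuous_prod

variable {f g : ℕ → ProbabilityMeasure E} {μ ρ : ProbabilityMeasure E}

theorem exists_subseq_tendsto_of_tendsto_mul (hf : Tendsto f atTop (𝓝 μ))
    (hfg : Tendsto (fun n => f n * g n) atTop (𝓝 ρ)) :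
    ∃ (ν : ProbabilityMeasure E) (φ : ℕ → ℕ), StrictMono φ ∧
      Tendsto (g ∘ φ) atTop (𝓝 ν) ∧ μ * ν = ρ := by
  obtain ⟨ν, φ, hφ, hν⟩ := exists_subseq_tendsto_of_isTightMeasureSet <|
    isTightMeasureSet_range_of_mul (isTightMeasureSet_range_of_tendsto hf)
      (isTightMeasureSet_range_of_tendsto hfg)
  exact ⟨ν, φ, hφ, hν, tendsto_nhds_unique ((hf.comp hφ.tendsto_atTop).mul hν)
    (hfg.comp hφ.tendsto_atTop)⟩

theorem exists_mem_mul_eq_of_tendsto {H : Set (ProbabilityMeasure E)} (hH : IsClosed H)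
    (hg : ∀ n, g n ∈ H) (hf : Tendsto f atTop (𝓝 μ))
    (hfg : Tendsto (fun n => f n * g n) atTop (𝓝 ρ)) : ∃ ν ∈ H, μ * ν = ρ := by
  obtain ⟨ν, φ, -, hν, hμν⟩ := exists_subseq_tendsto_of_tendsto_mul hf hfg
  exact ⟨ν, hH.mem_of_tendsto hν (Eventually.of_forall fun n => hg (φ n)), hμν⟩

theorem tendsto_of_tendsto_mul_of_tendsto_one (hf : Tendsto f atTop (𝓝 1))
    (hfg : Tendsto (fun n => f n * g n) atTop (𝓝 ρ)) : Tendsto g atTop (𝓝 ρ) := by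
  refine tendsto_of_subseq_tendsto fun ns hns => ?_
  obtain ⟨ν, φ, -, hν, hρ⟩ :=
    exists_subseq_tendsto_of_tendsto_mul (g := g ∘ ns) (hf.comp hns) (hfg.comp hns)
  rw [one_mul] at hρ
  exact ⟨φ, hρ ▸ hν⟩

end Factors

section Image

variable {E : Type*} [AddCommGroup E] [Module ℝ E] [TopologicalSpace E] [MeasurableSpace E]
  [BorelSpace E]

theorem image_one (μ : ProbabilityMeasure E) : image (1 : E ≃L[ℝ] E) μ = μ :=
  Subtype.ext Measure.map_id

theorem image_image (A B : E ≃L[ℝ] E) (μ : ProbabilityMeasure E) :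
    image A (image B μ) = image (A * B) μ :=
  Subtype.ext (Measure.map_map A.continuous.measurable B.continuous.measurable)

theorem image_diracProba (A : E ≃L[ℝ] E) (x : E) :
    image A (diracProba x) = diracProba (A x) :=
  Subtype.ext (Measure.map_dirac' A.continuous.measurable x)

theorem continuous_image (A : E ≃L[ℝ] E) : Continuous (image A) :=
  ProbabilityMeasure.continuous_map A.continuous

theorem tendsto_image_of_tendsto_zero {ι : Type*} {l : Filter ι} [l.IsCountablyGenerated]
    {A : ι → E ≃L[ℝ] E} (hA : ∀ x, Tendsto (fun i => A i x) l (𝓝 0))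
    (μ : ProbabilityMeasure E) : Tendsto (fun i => image (A i) μ) l (𝓝 (diracProba 0)) := by
  have hlim := (tendstoInDistribution_of_ae_tendsto (μ' := (μ : Measure E))
    (fun i => (A i).continuous.measurable.aemeasurable) (aemeasurable_const (b := (0 : E)))
    (ae_of_all _ hA)).tendsto
  have hconst : (⟨(μ : Measure E).map fun _ => (0 : E),
      Measure.isProbabilityMeasure_map aemeasurable_const⟩ : ProbabilityMeasure E) =
        diracProba 0 := Subtype.ext (by simp [diracProba])
  rwa [hconst] at hlim

variable [MeasurableAdd₂ E]

theorem image_mul (A : E ≃L[ℝ] E) (μ ν : ProbabilityMeasure E) :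
    image A (μ * ν) = image A μ * image A ν :=
  Subtype.ext (Measure.map_conv_continuousLinearMap (A : E →L[ℝ] E))

/-- The image under a fixed operator `A`, as an endomorphism of the convolution monoid. -/
noncomputable def imageHom (A : E ≃L[ℝ] E) : ProbabilityMeasure E →* ProbabilityMeasure E where
  toFun := image A
  map_one' := by rw [one_eq_dirac, image_diracProba, map_zero]
  map_mul' := image_mul A

theorem image_prod {ι : Type*} (A : E ≃L[ℝ] E) (s : Finset ι) (f : ι → ProbabilityMeasure E) :
    image A (∏ i ∈ s, f i) = ∏ i ∈ s, image A (f i) :=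
  map_prod (imageHom A) f s

end Image

section Decomposable

variable {E : Type*} [AddCommGroup E] [Module ℝ E] [TopologicalSpace E] [MeasurableSpace E]
  [BorelSpace E] [MeasurableAdd₂ E] {A B : E ≃L[ℝ] E} {μ ν μ' ν' : ProbabilityMeasure E}

theorem IsDecomposableWith.mul (h : IsDecomposableWith A μ ν) (h' : IsDecomposableWith A μ' ν') :
    IsDecomposableWith A (μ * μ') (ν * ν') :=
  calc μ * μ' = (image A μ * ν) * (image A μ' * ν') := congrArg₂ (· * ·) h h'
    _ = image A (μ * μ') * (ν * ν') := by rw [image_mul, mul_mul_mul_comm]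

theorem IsDecomposableWith.image_of_commute (h : IsDecomposableWith A μ ν) (hAB : Commute A B) :
    IsDecomposableWith A (image B μ) (image B ν) :=
  calc image B μ = image B (image A μ * ν) := congrArg (image B) h
    _ = image A (image B μ) * image B ν := by rw [image_mul, image_image, image_image, hAB.eq]

theorem isDecomposableWith_diracProba (A : E ≃L[ℝ] E) (x : E) :
    IsDecomposableWith A (diracProba x) (diracProba (x - A x)) := by
  rw [IsDecomposableWith, image_diracProba, diracProba_mul_diracProba, add_sub_cancel]

theorem IsDecomposableWith.eq_image_pow_mul_prod (h : IsDecomposableWith A μ ν) (n : ℕ) :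
    μ = image (A ^ n) μ * ∏ i ∈ Finset.range n, image (A ^ i) ν := by
  induction n with
  | zero => simp [image_one]
  | succ n ih =>
    have hstep : image (A ^ n) μ = image (A ^ (n + 1)) μ * image (A ^ n) ν := by
      rw [pow_succ, ← image_image, ← image_mul, ← h]
    rw [Finset.prod_range_succ_comm, ← mul_assoc, ← hstep, ← ih]

end Decomposable

theorem IsStronglyDecomposableWith.tendsto_prod_image_pow {E : Type*} [AddCommGroup E] [Module ℝ E]
    [TopologicalSpace E] [IsTopologicalAddGroup E] [PolishSpace E] [MeasurableSpace E]
    [BorelSpace E] {A : E ≃L[ℝ] E} {μ ν : ProbabilityMeasure E}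
    (h : IsStronglyDecomposableWith A μ ν) :
    Tendsto (fun n => ∏ i ∈ Finset.range n, image (A ^ i) ν) atTop (𝓝 μ) :=
  tendsto_of_tendsto_mul_of_tendsto_one h.2
    (tendsto_const_nhds.congr fun n => h.1.eq_image_pow_mul_prod n)

section Group

variable {E : Type*} [AddCommGroup E] [Module ℝ E] [TopologicalSpace E]
  {T : PosReal →* (E ≃L[ℝ] E)} {b : PosReal}

theorem IsContractiveGroup.tendsto_pow (hT : IsContractiveGroup T) (hb : (b : ℝ) < 1) (x : E) :
    Tendsto (fun n : ℕ => (T b ^ n) x) atTop (𝓝 0) := by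
  have hpow : Tendsto (fun n : ℕ => b ^ n) atTop (comap (fun t : PosReal => (t : ℝ)) (𝓝 0)) :=
    tendsto_comap_iff.2 (tendsto_pow_atTop_nhds_zero_of_lt_one b.2.le hb)
  simpa only [Function.comp_def, map_pow] using (hT.tendsto_zero x).comp hpow

variable [MeasurableSpace E] [BorelSpace E]

theorem IsContractiveGroup.isStronglyDecomposableWith_iff [MeasurableAdd₂ E]
    (hT : IsContractiveGroup T) (hb : (b : ℝ) < 1) {μ ν : ProbabilityMeasure E} :
    IsStronglyDecomposableWith (T b) μ ν ↔ IsDecomposableWith (T b) μ ν :=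
  and_iff_left (tendsto_image_of_tendsto_zero (hT.tendsto_pow hb) μ)

theorem IsContractiveGroup.continuous_image [IsTopologicalAddGroup E] [PolishSpace E]
    (hT : IsContractiveGroup T) :
    Continuous fun p : PosReal × ProbabilityMeasure E => image (T p.1) p.2 :=
  continuous_map_uncurry (A := fun t x => T t x) <|
    continuous_uncurry_of_separately_continuous (A := fun t => (T t : E →+ E))
      (fun t => (T t).continuous) hT.continuous

end Group

section CompletelyClosed

variable {E : Type*} [AddCommGroup E] [Module ℝ E] [TopologicalSpace E] [MeasurableSpace E]
  [BorelSpace E] [MeasurableAdd₂ E] {T : PosReal →* (E ≃L[ℝ] E)} {H : Set (ProbabilityMeasure E)}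

theorem IsCompletelyClosed.image_mem (hH : IsCompletelyClosed T H) {μ : ProbabilityMeasure E}
    (hμ : μ ∈ H) (a : PosReal) : image (T a) μ ∈ H := by
  simpa only [← one_eq_dirac, mul_one] using hH.image_mul_dirac_mem μ hμ a 0

theorem IsCompletelyClosed.prod_mem (hH : IsCompletelyClosed T H) {ι : Type*} {s : Finset ι}
    (hs : s.Nonempty) {m : ι → ProbabilityMeasure E} (hm : ∀ i ∈ s, m i ∈ H) :
    ∏ i ∈ s, m i ∈ H :=
  Finset.prod_induction_nonempty m (· ∈ H) (fun μ ν hμ hν => hH.mul_mem μ hμ ν hν) hs hm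

/-- The class of `A`-decomposable measures with a co-factor in `H`: condition (ii) of the theorem
when `A = T_b`. -/
def decomposableClass (A : E ≃L[ℝ] E) (H : Set (ProbabilityMeasure E)) :
    Set (ProbabilityMeasure E) :=
  {μ | ∃ ν ∈ H, IsDecomposableWith A μ ν}

/-- The normalized product `T_{1/c}(m_1 ⋯ m_k) δ_x`, whose weak limits form `K̃(H, b, (T_t))`. The
factors are indexed from `0`. -/
noncomputable def normalizedProd (T : PosReal →* (E ≃L[ℝ] E)) (m : ℕ → ProbabilityMeasure E)
    (c : PosReal) (k : ℕ) (x : E) : ProbabilityMeasure E :=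
  image (T c⁻¹) (∏ i ∈ Finset.range k, m i) * diracProba x

theorem normalizedProd_eq_image_mul (T : PosReal →* (E ≃L[ℝ] E)) (m : ℕ → ProbabilityMeasure E)
    (c d : PosReal) {k l : ℕ} (hkl : k ≤ l) (x y : E) :
    normalizedProd T m d l y = image (T (c / d)) (normalizedProd T m c k x) *
      (image (T d⁻¹) (∏ i ∈ Finset.Ico k l, m i) * diracProba (y - T (c / d) x)) := by
  have hscale : c / d * c⁻¹ = d⁻¹ := by rw [div_mul_eq_mul_div, mul_inv_cancel, one_div]
  rw [normalizedProd, normalizedProd, image_mul, image_diracProba, image_image, ← map_mul, hscale,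
    mul_mul_mul_comm, ← image_mul, Finset.prod_range_mul_prod_Ico _ hkl,
    diracProba_mul_diracProba, add_sub_cancel]

theorem normalizedProd_image_inv_pow (T : PosReal →* (E ≃L[ℝ] E)) (b : PosReal)
    (ν : ProbabilityMeasure E) (n : ℕ) :
    normalizedProd T (fun i => image (T (b ^ i)⁻¹) ν) (b ^ n)⁻¹ (n + 1) 0 =
      ∏ i ∈ Finset.range (n + 1), image (T b ^ i) ν := by
  rw [normalizedProd, ← one_eq_dirac, mul_one, inv_inv, image_prod, ← Finset.prod_range_reflect]
  refine Finset.prod_congr rfl fun i hi => ?_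
  have hi : i ≤ n := Nat.lt_succ_iff.1 (Finset.mem_range.1 hi)
  rw [image_image, ← map_mul, ← map_pow, Nat.add_sub_cancel, ← pow_sub b (Nat.sub_le n i),
    Nat.sub_sub_self hi]

end CompletelyClosed

section KTilde

variable {E : Type*} [AddCommGroup E] [Module ℝ E] [TopologicalSpace E] [IsTopologicalAddGroup E]
  [PolishSpace E] [MeasurableSpace E] [BorelSpace E] {T : PosReal →* (E ≃L[ℝ] E)} {b : PosReal}
  {H : Set (ProbabilityMeasure E)}

theorem isClosed_decomposableClass (A : E ≃L[ℝ] E) (hH : IsClosed H) :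
    IsClosed (decomposableClass A H) := by
  refine IsSeqClosed.isClosed fun f μ hf hμ => ?_
  choose g hg hfg using hf
  obtain ⟨ν, hν, hμν⟩ := exists_mem_mul_eq_of_tendsto hH hg
    (((continuous_image A).tendsto μ).comp hμ) (hμ.congr hfg)
  exact ⟨ν, hν, hμν.symm⟩

theorem isCompletelyClosed_decomposableClass (hH : IsCompletelyClosed T H) {A : E ≃L[ℝ] E}
    (hA : ∀ a, Commute A (T a)) : IsCompletelyClosed T (decomposableClass A H) where
  isClosed := isClosed_decomposableClass A hH.isClosed
  mul_mem := by
    rintro μ ⟨ν, hν, h⟩ μ' ⟨ν', hν', h'⟩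
    exact ⟨ν * ν', hH.mul_mem ν hν ν' hν', h.mul h'⟩
  image_mul_dirac_mem := by
    rintro μ ⟨ν, hν, h⟩ a x
    exact ⟨_, hH.image_mul_dirac_mem ν hν a (x - A x),
      (h.image_of_commute (hA a)).mul (isDecomposableWith_diracProba A x)⟩

theorem IsCompletelyClosed.kTilde_subset_decomposableClass (hT : IsContractiveGroup T)
    (hH : IsCompletelyClosed T H) : KTilde H b T ⊆ decomposableClass (T b) H := by
  rintro μ ⟨m, a, k, x, hm, ha, hk, -, hμ⟩
  have hk_lt : ∀ n, k n < k (n + 1) := fun n => hk n.lt_succ_self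
  have hratio : Tendsto (fun n => a n / a (n + 1)) atTop (𝓝 b) := tendsto_subtype_rng.2 ha
  have himage : Tendsto
      (fun n => image (T (a n / a (n + 1))) (normalizedProd T m (a n) (k n) (x n)))
      atTop (𝓝 (image (T b) μ)) :=
    (hT.continuous_image.tendsto (b, μ)).comp (hratio.prodMk_nhds hμ)
  have hsucc := (hμ.comp (tendsto_add_atTop_nat 1)).congr fun n =>
    normalizedProd_eq_image_mul T m (a n) (a (n + 1)) (hk_lt n).le (x n) (x (n + 1))
  obtain ⟨ν, hν, hμν⟩ := exists_mem_mul_eq_of_tendsto hH.isClosed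
    (fun n => hH.image_mul_dirac_mem _ (hH.prod_mem (Finset.nonempty_Ico.2 (hk_lt n))
      fun i _ => hm i) _ _) himage hsucc
  exact ⟨ν, hν, hμν.symm⟩

theorem IsCompletelyClosed.decomposableClass_subset_kTilde (hT : IsContractiveGroup T)
    (hb : (b : ℝ) < 1) (hH : IsCompletelyClosed T H) :
    decomposableClass (T b) H ⊆ KTilde H b T := by
  rintro μ ⟨ν, hν, h⟩
  have hratio : ∀ n, (b ^ n)⁻¹ / (b ^ (n + 1))⁻¹ = b := fun n => by
    rw [inv_div_inv, pow_succ', mul_div_cancel_right]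
  refine ⟨fun i => image (T (b ^ i)⁻¹) ν, fun n => (b ^ n)⁻¹, fun n => n + 1, fun _ => 0,
    fun i => hH.image_mem hν _, ?_, fun _ _ => Nat.succ_lt_succ, fun n => n.succ_pos, ?_⟩
  · exact tendsto_const_nhds.congr fun n => congrArg Subtype.val (hratio n).symm
  · refine (((hT.isStronglyDecomposableWith_iff hb).2 h).tendsto_prod_image_pow.comp
      (tendsto_add_atTop_nat 1)).congr fun n => ?_
    exact (normalizedProd_image_inv_pow T b ν n).symm

theorem IsCompletelyClosed.kTilde_eq_decomposableClass (hT : IsContractiveGroup T)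
    (hb : (b : ℝ) < 1) (hH : IsCompletelyClosed T H) :
    KTilde H b T = decomposableClass (T b) H :=
  (hH.kTilde_subset_decomposableClass hT).antisymm (hH.decomposableClass_subset_kTilde hT hb)

end KTilde

end OperatorDecomposable

theorem mainTheorem5_general {E : Type*} [AddCommGroup E] [Module ℝ E] [TopologicalSpace E]
    [IsTopologicalAddGroup E] [PolishSpace E]
    [MeasurableSpace E] [BorelSpace E]
    (T : OperatorDecomposable.PosReal →* (E ≃L[ℝ] E))
    (hT : OperatorDecomposable.IsContractiveGroup T)
    (b : OperatorDecomposable.PosReal) (hb : (b : ℝ) < 1)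
    (H : Set (ProbabilityMeasure E))
    (hH : OperatorDecomposable.IsCompletelyClosed T H) :
    OperatorDecomposable.IsCompletelyClosed T (OperatorDecomposable.KTilde H b T) ∧
    ∀ μ : ProbabilityMeasure E,
      (μ ∈ OperatorDecomposable.KTilde H b T ↔
        ∃ ν ∈ H, OperatorDecomposable.IsDecomposableWith (T b) μ ν) ∧
      (μ ∈ OperatorDecomposable.KTilde H b T ↔
        ∃ ν ∈ H, OperatorDecomposable.IsStronglyDecomposableWith (T b) μ ν) := by
  rw [hH.kTilde_eq_decomposableClass hT hb]
  refine ⟨OperatorDecomposable.isCompletelyClosed_decomposableClass hH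
    fun a => (Commute.all b a).map T, fun μ => ⟨Iff.rfl, ?_⟩⟩
  simp only [hT.isStronglyDecomposableWith_iff hb]
  rfl

theorem mainTheorem5 {E : Type*} [AddCommGroup E] [Module ℝ E] [TopologicalSpace E]
    [IsTopologicalAddGroup E] [ContinuousSMul ℝ E] [PolishSpace E]
    [MeasurableSpace E] [BorelSpace E]
    (T : OperatorDecomposable.PosReal →* (E ≃L[ℝ] E))
    (hT : OperatorDecomposable.IsContractiveGroup T)
    (b : OperatorDecomposable.PosReal) (hb : (b : ℝ) < 1)
    (H : Set (ProbabilityMeasure E))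
    (hH : OperatorDecomposable.IsCompletelyClosed T H) :
    OperatorDecomposable.IsCompletelyClosed T (OperatorDecomposable.KTilde H b T) ∧
    ∀ μ : ProbabilityMeasure E,
      (μ ∈ OperatorDecomposable.KTilde H b T ↔
        ∃ ν ∈ H, OperatorDecomposable.IsDecomposableWith (T b) μ ν) ∧
      (μ ∈ OperatorDecomposable.KTilde H b T ↔
        ∃ ν ∈ H, OperatorDecomposable.IsStronglyDecomposableWith (T b) μ ν) :=
  mainTheorem5_general T hT b hb H hH
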